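/- Let $X$ be a noetherian separated scheme, $Y$ an arbitrary scheme and $\varphi : X \to Y$ a morphism of schemes. For $y \in Y$ let $X_y = X \times_Y \operatorname{Spec} \mathcal{O}_{Y,y}$ denote the local fibre of $\varphi$ over $y$. (1) If $y \in Y$ is a point such that $X_y$ is affine, then there is an affine open neighbourhood $V$ of $y$ in $Y$ such that $\varphi^{-1}(V)$ is affine. (2) The set $\{y \in Y : X_y \text{ is affine}\}$ is equal to the union of all affine open subsets $V \subseteq Y$ whose preimage $\varphi^{-1}(V)$ is affine. In particular, this set is open in $Y$. -/

import Mathlib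

open CategoryTheory CategoryTheory.Limits AlgebraicGeometry

universe u

/-- The local fibre `X ×_Y Spec 𝒪_{Y,y}` of a morphism of schemes `φ : X ⟶ Y` at a point `y`. -/
noncomputable abbrev localFibre {X Y : Scheme.{u}} (φ : X ⟶ Y) (y : Y) : Scheme.{u} :=
  pullback φ (Y.fromSpecStalk y)

namespace AlgebraicGeometry

open TopologicalSpace Opposite

/-! The local fibre is the cofiltered limit of the preimages `φ ⁻¹ᵁ V`, with `V` running over the
affine open neighbourhoods of `y`; the transition maps are affine. Limit projections are then
affine, so one affine preimage makes the limit affine. Conversely, as the preimages are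
quasi-compact and quasi-separated, an affine limit forces some preimage to be affine
(`Scheme.exists_isAffine_of_isLimit`). -/

/-- A morphism to `Y` whose image lies in every open neighbourhood of `y` factors through
`Spec 𝒪_{Y,y}`. -/
lemma exists_comp_fromSpecStalk_eq {T Y : Scheme.{u}} (h : T ⟶ Y) (y : Y)
    (H : ∀ U : Y.Opens, y ∈ U → h ⁻¹ᵁ U = ⊤) :
    ∃ l : T ⟶ Spec (Y.presheaf.stalk y), l ≫ Y.fromSpecStalk y = h := by
  -- The stalk is a colimit, so the compatible maps `Γ(Y, U) ⟶ Γ(T, ⊤)` induce a ring map out of it.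
  let c : Cocone ((OpenNhds.inclusion y).op ⋙ Y.presheaf) :=
    { pt := Γ(T, ⊤)
      ι :=
        { app := fun U => h.appLE U.unop.1 ⊤ (H U.unop.1 U.unop.2).ge
          naturality := fun U V i => by
            refine (h.map_appLE _ ((OpenNhds.inclusion y).map i.unop).op).trans ?_
            exact (Category.comp_id _).symm } }
  let d : Y.presheaf.stalk y ⟶ Γ(T, ⊤) := colimit.desc _ c
  have hd (U : Y.Opens) (hU : y ∈ U) :
      Y.presheaf.germ U y hU ≫ d = h.appLE U ⊤ (H U hU).ge :=
    colimit.ι_desc c (op ⟨U, hU⟩)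
  obtain ⟨U, hU, hyU, -⟩ := exists_isAffineOpen_mem_and_subset (x := y) (U := ⊤) trivial
  refine ⟨T.topIso.inv ≫ (⊤ : T.Opens).toSpecΓ ≫ Spec.map d, ?_⟩
  rw [← hU.fromSpecStalk_eq_fromSpecStalk hyU, IsAffineOpen.fromSpecStalk, Category.assoc,
    Category.assoc, ← Spec.map_comp_assoc, hd, Scheme.Opens.toSpecΓ_SpecMap_appLE_assoc,
    hU.toSpecΓ_fromSpec, Scheme.Hom.resLE_comp_ι, Scheme.toIso_inv_ι_assoc]

/-- The affine open neighbourhoods of a point, ordered by inclusion. -/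
abbrev AffineNhds {Y : Scheme.{u}} (y : Y) : Type u := {V : Y.Opens // y ∈ V ∧ IsAffineOpen V}

instance {Y : Scheme.{u}} (y : Y) : IsCofiltered (AffineNhds y) := by
  have : Nonempty (AffineNhds y) := by
    obtain ⟨U, hU, hyU, -⟩ := exists_isAffineOpen_mem_and_subset (x := y) (U := ⊤) trivial
    exact ⟨⟨U, hyU, hU⟩⟩
  have : IsCodirectedOrder (AffineNhds y) := by
    refine ⟨fun V W => ?_⟩
    obtain ⟨U, hU, hyU, hle⟩ :=
      exists_isAffineOpen_mem_and_subset (x := y) (U := V.1 ⊓ W.1) ⟨V.2.1, W.2.1⟩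
    exact ⟨⟨U, hyU, hU⟩, fun _ hx => (hle hx).1, fun _ hx => (hle hx).2⟩
  infer_instance

variable {X Y : Scheme.{u}} (φ : X ⟶ Y) (y : Y)

/-- The diagram of the preimages of the affine open neighbourhoods of a point. -/
noncomputable def preimageDiagram : AffineNhds y ⥤ Scheme.{u} where
  obj V := (φ ⁻¹ᵁ V.1).toScheme
  map i := X.homOfLE (φ.preimage_mono i.le)

/-- The inclusion of a member of `preimageDiagram φ y` into `X`. -/
noncomputable def preimageDiagramι (V : AffineNhds y) : (preimageDiagram φ y).obj V ⟶ X :=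
  (φ ⁻¹ᵁ V.1).ι

instance (V : AffineNhds y) : IsOpenImmersion (preimageDiagramι φ y V) :=
  inferInstanceAs (IsOpenImmersion (φ ⁻¹ᵁ V.1).ι)

lemma preimageDiagram_map_ι {V W : AffineNhds y} (i : V ⟶ W) :
    (preimageDiagram φ y).map i ≫ preimageDiagramι φ y W = preimageDiagramι φ y V :=
  X.homOfLE_ι (φ.preimage_mono i.le)

lemma range_preimageDiagramι (V : AffineNhds y) :
    Set.range (preimageDiagramι φ y V) = (φ ⁻¹ᵁ V.1 : X.Opens) :=
  (φ ⁻¹ᵁ V.1).range_ι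

/-- The preimage of an inclusion of affine opens is an affine morphism. -/
lemma isAffineHom_homOfLE_preimage {V W : Y.Opens} (hV : IsAffineOpen V) (hW : IsAffineOpen W)
    (h : V ≤ W) : IsAffineHom (X.homOfLE (φ.preimage_mono h)) := by
  have : IsAffine V := hV
  have : IsAffine W := hW
  -- The inclusion is a base change of `V ⟶ W`, a morphism of affine schemes.
  have sq : IsPullback (X.homOfLE (φ.preimage_mono h)) (φ ∣_ V) (φ ∣_ W) (Y.homOfLE h) := by
    refine IsPullback.of_right (h₁₂ := (φ ⁻¹ᵁ W).ι) (h₂₂ := W.ι) (v₁₃ := φ) ?_ ?_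
      (isPullback_morphismRestrict φ W).flip
    · simpa using (isPullback_morphismRestrict φ V).flip
    · simp [← cancel_mono W.ι]
  exact MorphismProperty.of_isPullback sq.flip inferInstance

instance {V W : AffineNhds y} (i : V ⟶ W) : IsAffineHom ((preimageDiagram φ y).map i) :=
  isAffineHom_homOfLE_preimage φ V.2.2 W.2.2 i.le

/-- Points of `Spec 𝒪_{Y,y}` map to generizations of `y`, which lie in every open set containing
`y`. -/
lemma localFibre_fst_preimage {V : Y.Opens} (hV : y ∈ V) :
    (pullback.fst φ (Y.fromSpecStalk y)) ⁻¹ᵁ (φ ⁻¹ᵁ V) = ⊤ := by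
  rw [← Scheme.Hom.comp_preimage, pullback.condition, Scheme.Hom.comp_preimage]
  have : (Y.fromSpecStalk y) ⁻¹ᵁ V = ⊤ := by
    refine top_le_iff.mp fun x _ => ?_
    have hx : Y.fromSpecStalk y x ⤳ y := by
      have : Y.fromSpecStalk y x ∈ Set.range (Y.fromSpecStalk y) := ⟨x, rfl⟩
      rwa [Scheme.range_fromSpecStalk] at this
    exact hx.mem_open V.2 hV
  rw [this]
  rfl

/-- The projection of the local fibre to the preimage of an affine open neighbourhood. -/
noncomputable def localFibreToPreimage (V : AffineNhds y) :
    localFibre φ y ⟶ (preimageDiagram φ y).obj V :=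
  IsOpenImmersion.lift (preimageDiagramι φ y V) (pullback.fst φ (Y.fromSpecStalk y)) (by
    rintro _ ⟨x, rfl⟩
    rw [range_preimageDiagramι]
    exact (localFibre_fst_preimage φ y V.2.1).ge (show x ∈ ⊤ from trivial))

lemma localFibreToPreimage_ι (V : AffineNhds y) :
    localFibreToPreimage φ y V ≫ preimageDiagramι φ y V = pullback.fst φ (Y.fromSpecStalk y) :=
  IsOpenImmersion.lift_fac _ _ _

lemma localFibreToPreimage_map {V W : AffineNhds y} (i : V ⟶ W) :
    localFibreToPreimage φ y V ≫ (preimageDiagram φ y).map i = localFibreToPreimage φ y W := by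
  rw [← cancel_mono (preimageDiagramι φ y W), Category.assoc, preimageDiagram_map_ι,
    localFibreToPreimage_ι, localFibreToPreimage_ι]

/-- The local fibre as a cone over the preimages of the affine open neighbourhoods. -/
noncomputable def localFibreCone : Cone (preimageDiagram φ y) where
  pt := localFibre φ y
  π :=
    { app := localFibreToPreimage φ y
      naturality _ _ i := (Category.id_comp _).trans (localFibreToPreimage_map φ y i).symm }

variable {φ y} in
lemma cone_π_app_ι_eq (s : Cone (preimageDiagram φ y)) (V W : AffineNhds y) :
    s.π.app V ≫ preimageDiagramι φ y V = s.π.app W ≫ preimageDiagramι φ y W := by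
  have key {V W : AffineNhds y} (i : V ⟶ W) :
      s.π.app V ≫ preimageDiagramι φ y V = s.π.app W ≫ preimageDiagramι φ y W := by
    rw [← s.w i, Category.assoc, preimageDiagram_map_ι]
  exact (key (IsCofiltered.minToLeft V W)).symm.trans (key (IsCofiltered.minToRight V W))

variable {φ y} in
lemma exists_lift_localFibre (s : Cone (preimageDiagram φ y)) :
    ∃ l : s.pt ⟶ localFibre φ y, ∀ V : AffineNhds y,
      l ≫ pullback.fst φ (Y.fromSpecStalk y) = s.π.app V ≫ preimageDiagramι φ y V := by
  obtain ⟨W⟩ : Nonempty (AffineNhds y) := IsCofiltered.nonempty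
  obtain ⟨g, hg⟩ : ∃ g : s.pt ⟶ X, ∀ V, g = s.π.app V ≫ preimageDiagramι φ y V :=
    ⟨s.π.app W ≫ preimageDiagramι φ y W, cone_π_app_ι_eq s W⟩
  obtain ⟨l, hl⟩ := exists_comp_fromSpecStalk_eq (g ≫ φ) y fun U hyU => by
    obtain ⟨V, hV, hyV, hVU⟩ := exists_isAffineOpen_mem_and_subset hyU
    refine top_le_iff.mp fun x _ => hVU ?_
    have hx : g x ∈ Set.range (preimageDiagramι φ y ⟨V, hyV, hV⟩) := by
      rw [hg ⟨V, hyV, hV⟩]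
      exact ⟨s.π.app ⟨V, hyV, hV⟩ x, rfl⟩
    rwa [range_preimageDiagramι] at hx
  exact ⟨pullback.lift g l hl.symm, fun V => (pullback.lift_fst _ _ _).trans (hg V)⟩

/-- The local fibre is the limit of the preimages of the affine open neighbourhoods. -/
noncomputable def isLimitLocalFibreCone : IsLimit (localFibreCone φ y) where
  lift s := (exists_lift_localFibre s).choose
  fac s V := by
    refine (cancel_mono (preimageDiagramι φ y V)).mp ((Category.assoc _ _ _).trans ?_)
    refine Eq.trans ?_ ((exists_lift_localFibre s).choose_spec V)
    exact congrArg (_ ≫ ·) (localFibreToPreimage_ι φ y V)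
  uniq s m hm := by
    obtain ⟨W⟩ : Nonempty (AffineNhds y) := IsCofiltered.nonempty
    -- `Y.fromSpecStalk y` is a monomorphism, hence so is its base change to `X`.
    refine (cancel_mono (pullback.fst φ (Y.fromSpecStalk y))).mp ?_
    rw [(exists_lift_localFibre s).choose_spec W, ← hm W, Category.assoc]
    exact congrArg (m ≫ ·) (localFibreToPreimage_ι φ y W).symm

/-- The local fibre over a point of an affine open with affine preimage is affine. -/
lemma isAffine_localFibre_of_isAffineOpen {V : Y.Opens} (hy : y ∈ V) (hV : IsAffineOpen V)
    (hφV : IsAffineOpen (φ ⁻¹ᵁ V)) : IsAffine (localFibre φ y) := by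
  have := isAffineHom_π_app _ _ (isLimitLocalFibreCone φ y) ⟨V, hy, hV⟩
  have : IsAffine ((preimageDiagram φ y).obj ⟨V, hy, hV⟩) := hφV
  exact isAffine_of_isAffineHom (X := (localFibreCone φ y).pt)
    ((localFibreCone φ y).π.app ⟨V, hy, hV⟩)

/-- If the local fibre over a point is affine, then so is the preimage of some affine open
neighbourhood. -/
lemma exists_isAffineOpen_preimage_of_isAffine_localFibre [IsNoetherian X]
    (h : IsAffine (localFibre φ y)) :
    ∃ V : Y.Opens, y ∈ V ∧ IsAffineOpen V ∧ IsAffineOpen (φ ⁻¹ᵁ V) := by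
  -- Every open subset of a noetherian space is compact.
  have (V : AffineNhds y) : CompactSpace ((preimageDiagram φ y).obj V) :=
    isCompact_iff_compactSpace.mp (NoetherianSpace.isCompact (φ ⁻¹ᵁ V.1 : Set X))
  have (V : AffineNhds y) : QuasiSeparatedSpace ((preimageDiagram φ y).obj V) :=
    inferInstanceAs (QuasiSeparatedSpace (φ ⁻¹ᵁ V.1).toScheme)
  have : IsAffine (localFibreCone φ y).pt := h
  obtain ⟨V, hV⟩ := Scheme.exists_isAffine_of_isLimit _ _ (isLimitLocalFibreCone φ y)
  exact ⟨V.1, V.2.1, V.2.2, hV⟩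

end AlgebraicGeometry

theorem mainTheorem3 {X Y : Scheme.{u}} [IsNoetherian X] [X.IsSeparated] (φ : X ⟶ Y) :
    (∀ y : Y, IsAffine (localFibre φ y) →
      ∃ V : Y.Opens, y ∈ V ∧ IsAffineOpen V ∧ IsAffineOpen (φ ⁻¹ᵁ V)) ∧
    {y : Y | IsAffine (localFibre φ y)} =
      (⋃ V ∈ {V : Y.Opens | IsAffineOpen V ∧ IsAffineOpen (φ ⁻¹ᵁ V)}, (V : Set Y)) ∧
    IsOpen {y : Y | IsAffine (localFibre φ y)} := by
  have heq : {y : Y | IsAffine (localFibre φ y)} =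
      (⋃ V ∈ {V : Y.Opens | IsAffineOpen V ∧ IsAffineOpen (φ ⁻¹ᵁ V)}, (V : Set Y)) := by
    ext y
    simp only [Set.mem_iUnion, Set.mem_ofPred_eq, exists_prop]
    constructor
    · intro h
      obtain ⟨V, hy, hV, hφV⟩ := exists_isAffineOpen_preimage_of_isAffine_localFibre φ y h
      exact ⟨V, ⟨hV, hφV⟩, hy⟩
    · rintro ⟨V, ⟨hV, hφV⟩, hy⟩
      exact isAffine_localFibre_of_isAffineOpen φ y hy hV hφV
  refine ⟨fun y => exists_isAffineOpen_preimage_of_isAffine_localFibre φ y, heq, ?_⟩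
  rw [heq]
  exact isOpen_biUnion fun V _ => V.2
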